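/- Let $\mathcal A=\mathbb C\setminus(-\infty,0]$, let $\operatorname{Log}$ denote the principal logarithm in $\mathcal A$, and put $$G(z)=\left(1-\frac{\operatorname{Log} z}{\operatorname{Log}(1+z)}\right)z\operatorname{Log} z,\qquad z\in\mathcal A.$$ Then $G$ is holomorphic in $\mathcal A$, it extends the real function $x\mapsto\left(1-\frac{\ln x}{\ln(1+x)}\right)x\ln x$ on $(0,\infty)$, and for every $z\in\mathcal A$ it has the representation $$G(z)=1-\int_0^\infty\frac{\rho(t)}{z+t}\,dt$$ with an absolutely convergent integral, where $$\rho(t)=\begin{cases}-\dfrac{t\ln\left((1-t)/t^2\right)}{\ln(1-t)},& 0<t<1,\\[2ex]-\dfrac{t\left(\ln((t-1)/t)\right)^2}{(\ln(t-1))^2+\pi^2},& 1<t<\infty,\end{cases}$$ and $\rho(1)=-1$. -/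

import Mathlib

noncomputable section

/-- The function `G(z) = (1 - Log z / Log (1 + z)) z Log z`, with the principal logarithm; it is
of interest on the cut plane `ℂ ∖ (-∞, 0]`, which is `Complex.slitPlane`. -/
def bergG (z : ℂ) : ℂ :=
  (1 - Complex.log z / Complex.log (1 + z)) * z * Complex.log z

/-- The density `ρ` on the positive half-line. It is given by separate formulas on `(0, 1)` and
`(1, ∞)`; at `1` it takes the common one-sided limit `-1`. Values at `t ≤ 0` are irrelevant. -/
def bergRho (t : ℝ) : ℝ :=
  if t < 1 then
    -(t * Real.log ((1 - t) / t ^ 2) / Real.log (1 - t))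
  else if 1 < t then
    -(t * Real.log ((t - 1) / t) ^ 2 / (Real.log (t - 1) ^ 2 + Real.pi ^ 2))
  else -1

end

open Complex Set Filter Topology MeasureTheory

/-! Put `w = exp ζ`: the upper half-plane with both sides of its boundary becomes the closed strip
`0 ≤ im ζ ≤ π`, and `bergStrip` is continuous there, even at the branch point `ζ = πi`. For real `x
> 0`, integrate `(G(w) - G(x)) / (w - x) dw` around the rectangle `[-R, R] × [0, π]` and take
imaginary parts. Subtracting `G(x)` removes the pole, which would lie on the contour. The bottom
edge is real and drops out; the top edge carries the jump `π ρ` (`bergStrip_add_pi_mul_I_im`). As `R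
→ ∞` the left edge tends to `0` and the right edge to `π (1 - G(x))`, because `G → 1` at infinity
(`tendsto_bergStrip_atTop`). This is the representation for `x > 0`. Both sides are holomorphic in
the cut plane, so the identity theorem gives the rest (`bergG_representation_of_pos`). -/

/-! ### Holomorphy and values on the positive axis -/

lemma one_add_mem_slitPlane {z : ℂ} (hz : z ∈ slitPlane) : 1 + z ∈ slitPlane := by
  rw [mem_slitPlane_iff] at hz ⊢
  simp only [add_re, one_re, add_im, one_im, zero_add]
  rcases hz with h | h
  · left; linarith
  · right; exact h

lemma log_one_add_ne_zero {z : ℂ} (hz : z ≠ 0) (hz' : 1 + z ≠ 0) : log (1 + z) ≠ 0 := by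
  intro h
  have := exp_log hz'
  rw [h, exp_zero] at this
  exact hz (by linear_combination -this)

theorem differentiableOn_bergG : DifferentiableOn ℂ bergG slitPlane := by
  intro z hz
  have h1 : DifferentiableAt ℂ log z := (hasStrictDerivAt_log hz).hasDerivAt.differentiableAt
  have hs := one_add_mem_slitPlane hz
  have h2 : DifferentiableAt ℂ (fun z : ℂ => log (1 + z)) z :=
    DifferentiableAt.clog (by fun_prop) hs
  have h3 := log_one_add_ne_zero (slitPlane_ne_zero hz) (slitPlane_ne_zero hs)
  unfold bergG
  exact (((differentiableAt_const _).sub (h1.div h2 h3)).mul differentiableAt_id |>.mul h1).differentiableWithinAt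

theorem bergG_ofReal {x : ℝ} (hx : 0 < x) :
    bergG (x : ℂ) = (((1 - Real.log x / Real.log (1 + x)) * x * Real.log x : ℝ) : ℂ) := by
  unfold bergG
  rw [← ofReal_log hx.le, show (1 : ℂ) + x = ((1 + x : ℝ) : ℂ) by push_cast; rfl,
    ← ofReal_log (by linarith)]
  push_cast; rfl

/-! ### The logarithmic coordinate and boundary values -/

/-- `bergG` in the coordinate `ζ = Log z`, extended by the same formula to the line `im ζ = π`. -/
noncomputable def bergStrip (ζ : ℂ) : ℂ := (1 - ζ * (log (1 + exp ζ))⁻¹) * exp ζ * ζ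

/-- The closed strip corresponding to the upper half-plane with both sides of the boundary. -/
def closedStrip : Set ℂ := {ζ | 0 ≤ ζ.im ∧ ζ.im ≤ Real.pi}

lemma bergStrip_eq_bergG_exp {ζ : ℂ} (h1 : -Real.pi < ζ.im) (h2 : ζ.im ≤ Real.pi) :
    bergStrip ζ = bergG (exp ζ) := by
  unfold bergStrip bergG
  rw [log_exp h1 h2, div_eq_mul_inv]

lemma bergStrip_log {z : ℂ} (hz : z ≠ 0) : bergStrip (log z) = bergG z := by
  rw [bergStrip_eq_bergG_exp (neg_pi_lt_log_im z) (log_im_le_pi z), exp_log hz]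

lemma exp_mem_slitPlane_of_abs_im_lt {ζ : ℂ} (h1 : -Real.pi < ζ.im) (h2 : ζ.im < Real.pi) :
    exp ζ ∈ slitPlane := by
  rw [mem_slitPlane_iff_arg]
  refine ⟨?_, exp_ne_zero _⟩
  have := log_im (exp ζ)
  rw [log_exp h1 h2.le] at this
  rw [← this]; exact h2.ne

lemma differentiableAt_bergStrip {ζ : ℂ} (h1 : -Real.pi < ζ.im) (h2 : ζ.im < Real.pi) :
    DifferentiableAt ℂ bergStrip ζ := by
  have hs := exp_mem_slitPlane_of_abs_im_lt h1 h2
  have h : DifferentiableAt ℂ (fun ζ => bergG (exp ζ)) ζ :=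
    ((differentiableOn_bergG _ hs).differentiableAt
      (isOpen_slitPlane.mem_nhds hs)).comp ζ differentiable_exp.differentiableAt
  refine h.congr_of_eventuallyEq ?_
  filter_upwards [(isOpen_lt continuous_const continuous_im).mem_nhds h1,
    (isOpen_lt continuous_im continuous_const).mem_nhds h2] with w hw1 hw2
  exact bergStrip_eq_bergG_exp hw1 (le_of_lt hw2)

/-- At `0`, `|log w| ≥ |ln |w||` blows up, so the inverse tends to `0`, which is also the default
value of `(log 0)⁻¹`. On the negative axis the principal logarithm is continuous from above. -/
lemma continuousWithinAt_log_inv {w : ℂ} (hw : w ≠ 1) (hi : 0 ≤ w.im) :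
    ContinuousWithinAt (fun w => (log w)⁻¹) {w : ℂ | 0 ≤ w.im} w := by
  by_cases h0 : w = 0
  · subst h0
    have hn : Tendsto (fun w : ℂ => ‖(log w)⁻¹‖) (𝓝 0) (𝓝 0) := by
      have h1 : Tendsto (fun w : ℂ => |Real.log ‖w‖|⁻¹) (𝓝 0) (𝓝 0) := by
        have : ContinuousAt (fun r : ℝ => |Real.log r|⁻¹) 0 := by
          rw [continuousAt_iff_punctured_nhds]
          simp only [Real.log_zero, abs_zero, inv_zero]
          exact (tendsto_abs_atBot_atTop.comp Real.tendsto_log_nhdsNE_zero).inv_tendsto_atTop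
        have h2 := this.tendsto.comp (show Tendsto (fun w : ℂ => ‖w‖) (𝓝 0) (𝓝 0) by
          simpa using (continuous_norm (E := ℂ)).tendsto 0)
        simpa [Function.comp_def] using h2
      refine squeeze_zero' (Eventually.of_forall fun _ => norm_nonneg _) ?_ h1
      have : ∀ᶠ w : ℂ in 𝓝 0, ‖w‖ < 1 := by
        filter_upwards [Metric.ball_mem_nhds (0 : ℂ) one_pos] with w hw
        simpa using hw
      filter_upwards [this] with w hw
      by_cases hw0 : w = 0
      · simp [hw0]
      rw [norm_inv]
      have hlog : Real.log ‖w‖ ≠ 0 := (Real.log_neg (norm_pos_iff.2 hw0) hw).ne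
      refine inv_anti₀ (abs_pos.2 hlog) ?_
      rw [← log_re]; exact abs_re_le_norm _
    have : ContinuousAt (fun w : ℂ => (log w)⁻¹) 0 := by
      unfold ContinuousAt
      simpa using tendsto_zero_iff_norm_tendsto_zero.2 hn
    exact this.continuousWithinAt
  · have hl : log w ≠ 0 := by
      intro h
      have := exp_log h0
      rw [h, exp_zero] at this
      exact hw this.symm
    refine ContinuousWithinAt.inv₀ ?_ hl
    by_cases hs : w ∈ slitPlane
    · exact (continuousAt_clog hs).continuousWithinAt
    · rw [mem_slitPlane_iff] at hs
      push Not at hs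
      refine continuousWithinAt_log_of_re_neg_of_im_zero (lt_of_le_of_ne hs.1 ?_) hs.2
      intro h
      exact h0 (Complex.ext h hs.2)

lemma exp_im_nonneg {ζ : ℂ} (hζ : ζ ∈ closedStrip) : 0 ≤ (exp ζ).im := by
  rw [exp_im]
  exact mul_nonneg (Real.exp_pos _).le (Real.sin_nonneg_of_nonneg_of_le_pi hζ.1 hζ.2)

lemma continuousOn_bergStrip : ContinuousOn bergStrip closedStrip := by
  intro ζ hζ
  have h1 : ContinuousWithinAt (fun ζ : ℂ => (log (1 + exp ζ))⁻¹) closedStrip ζ := by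
    refine (continuousWithinAt_log_inv (w := 1 + exp ζ) (by simp) ?_).comp
      (f := fun ζ : ℂ => 1 + exp ζ) (by fun_prop) ?_
    · simpa using exp_im_nonneg hζ
    · intro w hw
      simpa using exp_im_nonneg hw
  exact ((continuousWithinAt_const.sub (continuousWithinAt_id.mul h1)).mul
    (by fun_prop)).mul continuousWithinAt_id

lemma exp_ofReal_add_pi_mul_I (t : ℝ) : exp (t + Real.pi * I) = ((-Real.exp t : ℝ) : ℂ) := by
  rw [exp_add, exp_pi_mul_I]; push_cast; ring

lemma log_ofReal_of_neg {x : ℝ} (hx : x < 0) : log (x : ℂ) = Real.log (-x) + Real.pi * I := by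
  apply Complex.ext
  · simp [log_re]
  · simp [log_im, arg_ofReal_of_neg hx]

/-- The jump of `bergG` across the cut is the density `bergRho`. -/
theorem bergStrip_add_pi_mul_I_im (t : ℝ) :
    (bergStrip (t + Real.pi * I)).im = Real.pi * bergRho (Real.exp t) := by
  set s := Real.exp t with hs
  have hspos : 0 < s := Real.exp_pos t
  have ht : Real.log s = t := Real.log_exp t
  have he : exp (t + Real.pi * I) = ((-s : ℝ) : ℂ) := exp_ofReal_add_pi_mul_I t
  have h1s : (1 : ℂ) + ((-s : ℝ) : ℂ) = ((1 - s : ℝ) : ℂ) := by push_cast; ring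
  unfold bergStrip bergRho
  rw [he, h1s]
  rcases lt_trichotomy s 1 with h | h | h
  · rw [if_pos h, ← ofReal_log (by linarith), ← ofReal_inv]
    have hl : Real.log (1 - s) ≠ 0 := (Real.log_neg (by linarith) (by linarith)).ne
    rw [Real.log_div (by linarith) (by positivity), Real.log_pow, ht]
    simp
    field_simp
    ring
  -- At the branch point `(log 0)⁻¹ = 0`, so `bergStrip` equals `-πi`, matching `ρ(1) = -1`.
  · rw [if_neg h.not_lt, if_neg h.not_gt, h]
    simp
  · rw [if_neg h.not_gt, if_pos h, log_ofReal_of_neg (by linarith), neg_sub,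
      Real.log_div (by linarith) (by linarith), ht]
    have hden : 0 < Real.log (s - 1) ^ 2 + Real.pi ^ 2 := by positivity
    have hn : normSq (Real.log (s - 1) + Real.pi * I) = Real.log (s - 1) ^ 2 + Real.pi ^ 2 :=
      normSq_add_mul_I _ _
    simp [hn]
    field_simp
    ring

/-! ### Continuity and growth of the density -/

lemma bergRho_eq {s : ℝ} (hs : 0 < s) :
    bergRho s = Real.pi⁻¹ * (bergStrip (Real.log s + Real.pi * I)).im := by
  rw [bergStrip_add_pi_mul_I_im, Real.exp_log hs, inv_mul_cancel_left₀ Real.pi_ne_zero]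

lemma continuousOn_bergRho : ContinuousOn bergRho (Ioi 0) := by
  have h : ContinuousOn (fun s : ℝ => Real.pi⁻¹ * (bergStrip (Real.log s + Real.pi * I)).im)
      (Ioi 0) := by
    refine continuousOn_const.mul (continuous_im.comp_continuousOn ?_)
    refine continuousOn_bergStrip.comp (ContinuousOn.add ?_ continuousOn_const) ?_
    · exact continuous_ofReal.comp_continuousOn
        (Real.continuousOn_log.mono fun x hx => ne_of_gt hx)
    · intro s _
      simp [closedStrip, Real.pi_pos.le]
  exact h.congr fun s hs => bergRho_eq hs

lemma abs_bergRho_le_of_lt_one {t : ℝ} (h0 : 0 < t) (h1 : t < 1) :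
    |bergRho t| ≤ 1 + 2 * |Real.log t| := by
  have hl : Real.log (1 - t) ≤ -t := by
    have := Real.log_le_sub_one_of_pos (show 0 < 1 - t by linarith)
    linarith
  have hlt : Real.log t < 0 := Real.log_neg h0 h1
  unfold bergRho
  rw [if_pos h1, Real.log_div (by linarith) (by positivity), Real.log_pow]
  have hl0 : Real.log (1 - t) ≠ 0 := by linarith
  have : -(t * (Real.log (1 - t) - (2 : ℕ) * Real.log t) / Real.log (1 - t))
      = -t + 2 * Real.log t * (t / Real.log (1 - t)) := by
    field_simp; push_cast; ring
  rw [this]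
  have hq : |t / Real.log (1 - t)| ≤ 1 := by
    rw [abs_div, div_le_one (abs_pos.2 hl0), abs_of_pos h0, abs_of_neg (by linarith)]
    linarith
  calc |-t + 2 * Real.log t * (t / Real.log (1 - t))|
      ≤ |-t| + |2 * Real.log t * (t / Real.log (1 - t))| := abs_add_le _ _
    _ ≤ 1 + 2 * |Real.log t| := by
      refine add_le_add (by rw [abs_neg, abs_of_pos h0]; exact h1.le) ?_
      rw [abs_mul, abs_mul, abs_two]
      exact mul_le_of_le_one_right (by positivity) hq

lemma abs_bergRho_le_of_two_le {t : ℝ} (h : 2 ≤ t) : |bergRho t| ≤ 4 * t⁻¹ := by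
  have h1 : 0 < (t - 1) / t := div_pos (by linarith) (by linarith)
  have hu : -Real.log ((t - 1) / t) ≤ 2 / t := by
    rw [← Real.log_inv, inv_div]
    have h2 := Real.log_le_sub_one_of_pos (show 0 < t / (t - 1) from
      div_pos (by linarith) (by linarith))
    refine h2.trans ?_
    rw [div_sub_one (by linarith), div_le_div_iff₀ (by linarith) (by linarith)]
    linarith
  have hl : Real.log ((t - 1) / t) ≤ 0 :=
    Real.log_nonpos h1.le ((div_le_one (by linarith)).2 (by linarith))
  have hsq : Real.log ((t - 1) / t) ^ 2 ≤ (2 / t) ^ 2 := by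
    rw [← neg_sq]; exact pow_le_pow_left₀ (by linarith) hu 2
  have hden : 1 ≤ Real.log (t - 1) ^ 2 + Real.pi ^ 2 := by
    nlinarith [Real.pi_gt_three, sq_nonneg (Real.log (t - 1))]
  unfold bergRho
  rw [if_neg (by linarith), if_pos (by linarith), abs_neg, abs_of_nonneg (by positivity)]
  calc t * Real.log ((t - 1) / t) ^ 2 / (Real.log (t - 1) ^ 2 + Real.pi ^ 2)
      ≤ t * Real.log ((t - 1) / t) ^ 2 := div_le_self (by positivity) hden
    _ ≤ t * (2 / t) ^ 2 := by gcongr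
    _ = 4 * t⁻¹ := by field_simp; norm_num

lemma bergRho_isBigO_atTop : bergRho =O[atTop] (fun t : ℝ => t ^ (-(1 : ℝ))) := by
  refine Asymptotics.IsBigO.of_bound 4 ?_
  filter_upwards [eventually_ge_atTop 2] with t ht
  rw [Real.rpow_neg_one, Real.norm_eq_abs, Real.norm_eq_abs, abs_of_pos (a := t⁻¹) (by positivity)]
  exact abs_bergRho_le_of_two_le ht

lemma bergRho_isBigO_zero : bergRho =O[𝓝[>] 0] (fun t : ℝ => t ^ (-(1 / 4 : ℝ))) := by
  have h1 : (fun t : ℝ => 1 + 2 * |Real.log t|) =O[𝓝[>] 0] (fun t : ℝ => t ^ (-(1 / 4 : ℝ))) := by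
    refine Asymptotics.IsBigO.add ?_ ?_
    · refine Asymptotics.IsBigO.of_bound 1 ?_
      filter_upwards [Ioo_mem_nhdsGT (one_pos (α := ℝ))] with t ht
      rw [norm_one, one_mul, Real.norm_eq_abs, abs_of_pos (Real.rpow_pos_of_pos ht.1 _)]
      exact Real.one_le_rpow_of_pos_of_le_one_of_nonpos ht.1 ht.2.le (by norm_num)
    · exact ((isLittleO_log_rpow_nhdsGT_zero (by norm_num)).isBigO.norm_left).const_mul_left 2
  refine Asymptotics.IsBigO.trans (Asymptotics.IsBigO.of_bound 1 ?_) h1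
  filter_upwards [Ioo_mem_nhdsGT (one_pos (α := ℝ))] with t ht
  rw [one_mul, Real.norm_eq_abs, Real.norm_eq_abs]
  exact (abs_bergRho_le_of_lt_one ht.1 ht.2).trans (le_abs_self _)

lemma integrableOn_bergRho_div_one_add :
    IntegrableOn (fun t : ℝ => |bergRho t| / (1 + t)) (Ioi 0) := by
  have hl : LocallyIntegrableOn bergRho (Ioi 0) :=
    continuousOn_bergRho.locallyIntegrableOn measurableSet_Ioi
  -- Mellin convergence at exponent `1/2`, strictly between the orders `1/4` at `0` and `1` at
  -- infinity; then `1 / (1 + t) ≤ t ^ (-1/2)`.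
  have hm : IntegrableOn (fun t : ℝ => t ^ ((1 / 2 : ℝ) - 1) * |bergRho t|) (Ioi 0) := by
    refine mellin_convergent_of_isBigO_scalar (a := 1) (b := 1 / 4) hl.norm
      bergRho_isBigO_atTop.norm_left (by norm_num) bergRho_isBigO_zero.norm_left (by norm_num)
  refine Integrable.mono' hm ?_ ?_
  · refine ContinuousOn.aestronglyMeasurable ?_ measurableSet_Ioi
    refine continuousOn_bergRho.abs.div (by fun_prop) fun t ht => ?_
    have : 0 < t := ht
    positivity
  · refine (ae_restrict_iff' measurableSet_Ioi).2 (Eventually.of_forall fun t ht => ?_)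
    have ht' : 0 < t := ht
    rw [Real.norm_eq_abs, abs_of_nonneg (by positivity), div_eq_inv_mul]
    refine mul_le_mul_of_nonneg_right ?_ (abs_nonneg _)
    rw [show (1 / 2 : ℝ) - 1 = -(1 / 2) by norm_num, Real.rpow_neg ht'.le, ← Real.sqrt_eq_rpow]
    refine inv_anti₀ (Real.sqrt_pos.2 ht') (Real.sqrt_le_iff.2 ⟨by positivity, by nlinarith⟩)

/-! ### The integral as a holomorphic function; the identity theorem -/

/-- On a neighbourhood of a point of the cut plane, `w + t` grows linearly in `t`, uniformly. -/
lemma exists_norm_add_ge {z : ℂ} (hz : z ∈ slitPlane) :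
    ∃ c > 0, ∀ w ∈ Metric.ball z c, ∀ t : ℝ, 0 ≤ t → c * (1 + t) ≤ ‖w + t‖ := by
  obtain ⟨δ, hδ, hball⟩ := Metric.isOpen_iff.1 isOpen_slitPlane z hz
  have hδ' : ∀ t : ℝ, 0 ≤ t → δ ≤ ‖z + t‖ := by
    intro t ht
    by_contra! h
    have : ((-t : ℝ) : ℂ) ∈ slitPlane := hball (by
      rw [Metric.mem_ball, dist_comm, dist_eq_norm]
      push_cast; rwa [sub_neg_eq_add])
    rw [ofReal_mem_slitPlane] at this
    linarith
  have hn : 0 ≤ ‖z‖ := norm_nonneg z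
  obtain ⟨c, hc, hcz⟩ : ∃ c > 0, ∀ t : ℝ, 0 ≤ t → c * (1 + t) ≤ ‖z + t‖ := by
    -- For `t ≤ 2‖z‖ + 1` the distance `δ` to the cut suffices; for larger `t`, `‖z + t‖ ≥ t - ‖z‖ ≥
    -- (1 + t) / 2`.
    refine ⟨min (1 / 2) (δ / (2 * ‖z‖ + 2)), by positivity, fun t ht => ?_⟩
    rcases le_total t (2 * ‖z‖ + 1) with h | h
    · calc min (1 / 2) (δ / (2 * ‖z‖ + 2)) * (1 + t)
          ≤ δ / (2 * ‖z‖ + 2) * (2 * ‖z‖ + 2) := by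
            exact mul_le_mul (min_le_right _ _) (by linarith) (by positivity) (by positivity)
        _ = δ := by field_simp
        _ ≤ _ := hδ' t ht
    · calc min (1 / 2) (δ / (2 * ‖z‖ + 2)) * (1 + t) ≤ 1 / 2 * (1 + t) := by
            gcongr
            exact min_le_left _ _
        _ ≤ t - ‖z‖ := by linarith
        _ ≤ ‖z + t‖ := by
            have := norm_sub_norm_le (t : ℂ) (-z)
            rw [norm_neg, sub_neg_eq_add, add_comm (t : ℂ), norm_real, Real.norm_eq_abs,
              abs_of_nonneg ht] at this
            exact this
  refine ⟨c / 2, by positivity, fun w hw t ht => ?_⟩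
  rw [Metric.mem_ball, dist_comm, dist_eq_norm] at hw
  have h1 := hcz t ht
  have h2 : ‖z + t‖ ≤ ‖w + t‖ + ‖z - w‖ := by
    have := norm_add_le (w + t) (z - w)
    rwa [show w + t + (z - w) = z + t by ring] at this
  nlinarith

lemma aestronglyMeasurable_bergRho : AEStronglyMeasurable bergRho (volume.restrict (Ioi 0)) :=
  continuousOn_bergRho.aestronglyMeasurable measurableSet_Ioi

theorem integrableOn_bergRho_div {z : ℂ} (hz : z ∈ slitPlane) :
    IntegrableOn (fun t : ℝ => (bergRho t : ℂ) / (z + (t : ℂ))) (Ioi (0 : ℝ)) volume := by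
  obtain ⟨c, hc, h⟩ := exists_norm_add_ge hz
  refine Integrable.mono' (integrableOn_bergRho_div_one_add.const_mul c⁻¹) ?_ ?_
  · exact ((continuous_ofReal.comp_aestronglyMeasurable
      aestronglyMeasurable_bergRho).aemeasurable.div (by fun_prop)).aestronglyMeasurable
  · refine (ae_restrict_iff' measurableSet_Ioi).2 (Eventually.of_forall fun t ht => ?_)
    have ht' : 0 < t := ht
    rw [norm_div, norm_real, Real.norm_eq_abs]
    calc |bergRho t| / ‖z + t‖ ≤ |bergRho t| / (c * (1 + t)) := by
          gcongr
          exact h z (Metric.mem_ball_self hc) t ht'.le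
      _ = c⁻¹ * (|bergRho t| / (1 + t)) := by field_simp

theorem differentiableOn_integral_bergRho_div :
    DifferentiableOn ℂ (fun z => ∫ t in Ioi (0 : ℝ), (bergRho t : ℂ) / (z + (t : ℂ)))
      slitPlane := by
  intro z hz
  obtain ⟨c, hc, h⟩ := exists_norm_add_ge hz
  have hm : ∀ w : ℂ, AEStronglyMeasurable (fun t : ℝ => (bergRho t : ℂ) / (w + (t : ℂ)))
      (volume.restrict (Ioi 0)) := fun w =>
    ((continuous_ofReal.comp_aestronglyMeasurable
      aestronglyMeasurable_bergRho).aemeasurable.div (by fun_prop)).aestronglyMeasurable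
  refine (hasDerivAt_integral_of_dominated_loc_of_deriv_le (Metric.ball_mem_nhds z hc)
    (Eventually.of_forall hm) (integrableOn_bergRho_div hz)
    (F' := fun w t => -(bergRho t : ℂ) / (w + (t : ℂ)) ^ 2) ?_
    (bound := fun t => (c ^ 2)⁻¹ * (|bergRho t| / (1 + t))) ?_
    (integrableOn_bergRho_div_one_add.const_mul _) ?_).2.differentiableAt.differentiableWithinAt
  · exact ((continuous_ofReal.comp_aestronglyMeasurable
      aestronglyMeasurable_bergRho).aemeasurable.neg.div (by fun_prop)).aestronglyMeasurable
  · refine (ae_restrict_iff' measurableSet_Ioi).2 (Eventually.of_forall fun t ht w hw => ?_)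
    have ht' : 0 < t := ht
    rw [norm_div, norm_neg, norm_pow, norm_real, Real.norm_eq_abs]
    have hb : c ^ 2 * (1 + t) ≤ ‖w + t‖ ^ 2 := by
      calc c ^ 2 * (1 + t) ≤ c ^ 2 * (1 + t) ^ 2 := by gcongr; nlinarith
        _ = (c * (1 + t)) ^ 2 := by ring
        _ ≤ _ := by gcongr; exact h w hw t ht'.le
    calc |bergRho t| / ‖w + t‖ ^ 2 ≤ |bergRho t| / (c ^ 2 * (1 + t)) := by gcongr
      _ = (c ^ 2)⁻¹ * (|bergRho t| / (1 + t)) := by field_simp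
  · refine (ae_restrict_iff' measurableSet_Ioi).2 (Eventually.of_forall fun t ht w hw => ?_)
    have ht' : 0 < t := ht
    have hne : w + t ≠ 0 := by
      have := h w hw t ht'.le
      intro h0
      rw [h0, norm_zero] at this
      have : 0 < c * (1 + t) := by positivity
      linarith
    have := (hasDerivAt_const w (bergRho t : ℂ)).div ((hasDerivAt_id w).add_const (t : ℂ)) hne
    simpa [Pi.div_def] using this

theorem bergG_representation_of_pos
    (h : ∀ x : ℝ, 0 < x →
      bergG x = 1 - ∫ t in Ioi (0 : ℝ), (bergRho t : ℂ) / ((x : ℂ) + (t : ℂ))) {z : ℂ}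
    (hz : z ∈ slitPlane) :
    bergG z = 1 - ∫ t in Ioi (0 : ℝ), (bergRho t : ℂ) / (z + (t : ℂ)) := by
  have h1 := differentiableOn_bergG.analyticOnNhd isOpen_slitPlane
  have h2 := ((differentiableOn_const (1 : ℂ)).sub
    differentiableOn_integral_bergRho_div).analyticOnNhd isOpen_slitPlane
  refine h1.eqOn_of_preconnected_of_frequently_eq h2
    (starConvex_one_slitPlane.isPathConnected one_mem_slitPlane).isConnected.isPreconnected
    one_mem_slitPlane ?_ hz
  have ht : Tendsto (fun x : ℝ => (x : ℂ)) (𝓝[>] 1) (𝓝[≠] 1) := by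
    refine tendsto_nhdsWithin_iff.2 ⟨?_, ?_⟩
    · have := (continuous_ofReal.tendsto (1 : ℝ)).mono_left (nhdsWithin_le_nhds (s := Ioi 1))
      simpa using this
    · filter_upwards [self_mem_nhdsWithin] with x hx
      have hx' : (1 : ℝ) < x := hx
      simpa using hx'.ne'
  refine ht.frequently (Eventually.frequently ?_)
  filter_upwards [self_mem_nhdsWithin] with x hx
  have hx' : (1 : ℝ) < x := hx
  simpa using h x (by linarith)

/-! ### The Cauchy quotient on the strip -/

/-- The Cauchy kernel difference quotient `(G(w) - G(x)) / (w - x) * w` at `w = exp ζ`, with the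
removable singularity at `ζ = log x` removed. -/
noncomputable def cauchyQuotient (x : ℝ) (ζ : ℂ) : ℂ :=
  dslope bergStrip (Real.log x : ℂ) ζ / dslope exp (Real.log x : ℂ) ζ * exp ζ

lemma exp_eq_exp_ofReal {ζ : ℂ} (hζ : ζ ∈ closedStrip) {a : ℝ} (h : exp ζ = exp a) : ζ = a := by
  have h1 := log_exp (x := ζ) (by linarith [hζ.1, Real.pi_pos]) hζ.2
  have h2 := log_exp (x := (a : ℂ)) (by simp [Real.pi_pos]) (by simp [Real.pi_pos.le])
  rw [← h1, h, h2]

lemma ofReal_mem_closedStrip (t : ℝ) : (t : ℂ) ∈ closedStrip := by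
  simp [closedStrip, Real.pi_pos.le]

lemma add_mul_I_mem_closedStrip (t : ℝ) {y : ℝ} (h0 : 0 ≤ y) (h1 : y ≤ Real.pi) :
    (t + y * I : ℂ) ∈ closedStrip := by
  simp [closedStrip, h0, h1]

lemma bergStrip_ofReal_log {x : ℝ} (hx : 0 < x) : bergStrip (Real.log x : ℂ) = bergG x := by
  rw [ofReal_log hx.le, bergStrip_log (by exact_mod_cast hx.ne')]

lemma cauchyQuotient_eq {x : ℝ} (hx : 0 < x) {ζ : ℂ} (h : ζ ≠ Real.log x) :
    cauchyQuotient x ζ = (bergStrip ζ - bergG x) / (exp ζ - x) * exp ζ := by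
  unfold cauchyQuotient
  rw [dslope_of_ne _ h, dslope_of_ne _ h, slope_def_field, slope_def_field,
    bergStrip_ofReal_log hx, div_div_div_cancel_right₀ (sub_ne_zero.2 h), ← ofReal_exp,
    Real.exp_log hx]

/-- The strip has height only `π`, so `log` inverts `exp` on it and `exp` takes each value once. -/
lemma dslope_exp_ne_zero {ζ : ℂ} (hζ : ζ ∈ closedStrip) (a : ℝ) : dslope exp (a : ℂ) ζ ≠ 0 := by
  by_cases h : ζ = a
  · rw [h, dslope_same, Complex.deriv_exp]; exact exp_ne_zero _
  · rw [dslope_of_ne _ h, slope_def_field]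
    exact div_ne_zero (sub_ne_zero.2 fun he => h (exp_eq_exp_ofReal hζ he)) (sub_ne_zero.2 h)

lemma differentiableAt_bergStrip_ofReal (t : ℝ) : DifferentiableAt ℂ bergStrip t :=
  differentiableAt_bergStrip (by simp [Real.pi_pos]) (by simp [Real.pi_pos])

lemma continuousOn_cauchyQuotient (x : ℝ) : ContinuousOn (cauchyQuotient x) closedStrip := by
  intro ζ hζ
  refine ContinuousWithinAt.mul (ContinuousWithinAt.div ?_ ?_ (dslope_exp_ne_zero hζ _))
    (by fun_prop)
  all_goals by_cases h : ζ = (Real.log x : ℂ)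
  · rw [h]
    exact (continuousAt_dslope_same.2 (differentiableAt_bergStrip_ofReal _)).continuousWithinAt
  · exact (continuousWithinAt_dslope_of_ne h).2 (continuousOn_bergStrip ζ hζ)
  · rw [h]
    exact (continuousAt_dslope_same.2 differentiable_exp.differentiableAt).continuousWithinAt
  · exact (continuousWithinAt_dslope_of_ne h).2 continuous_exp.continuousWithinAt

lemma differentiableAt_cauchyQuotient (x : ℝ) {ζ : ℂ} (h0 : 0 < ζ.im) (h1 : ζ.im < Real.pi) :
    DifferentiableAt ℂ (cauchyQuotient x) ζ := by
  have h : ζ ≠ (Real.log x : ℂ) := by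
    rintro rfl
    simp at h0
  exact (((differentiableAt_dslope_of_ne h).2
    (differentiableAt_bergStrip (by linarith) h1)).div
    ((differentiableAt_dslope_of_ne h).2 differentiable_exp.differentiableAt)
    (dslope_exp_ne_zero ⟨h0.le, h1.le⟩ _)).mul differentiable_exp.differentiableAt

lemma bergG_ofReal_im {x : ℝ} (hx : 0 < x) : (bergG x).im = 0 := by
  rw [bergG_ofReal hx, ofReal_im]

lemma cauchyQuotient_ofReal_im {x t : ℝ} (hx : 0 < x) (h : t ≠ Real.log x) :
    (cauchyQuotient x t).im = 0 := by
  rw [cauchyQuotient_eq hx (by exact_mod_cast h),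
    bergStrip_eq_bergG_exp (by simp [Real.pi_pos]) (by simp [Real.pi_pos.le]),
    ← ofReal_exp, bergG_ofReal hx, bergG_ofReal (Real.exp_pos t)]
  norm_cast

lemma cauchyQuotient_add_pi_mul_I_im {x : ℝ} (hx : 0 < x) (t : ℝ) :
    (cauchyQuotient x (t + Real.pi * I)).im =
      Real.pi * (Real.exp t * (bergRho (Real.exp t) / (x + Real.exp t))) := by
  have hne : (t + Real.pi * I : ℂ) ≠ Real.log x := by
    intro h
    have := congrArg im h
    simp [Real.pi_ne_zero] at this
  rw [cauchyQuotient_eq hx hne, exp_ofReal_add_pi_mul_I]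
  have h1 : (((-Real.exp t : ℝ) : ℂ) - x) = ((-(x + Real.exp t) : ℝ) : ℂ) := by
    push_cast; ring
  have hp := Real.exp_pos t
  rw [h1, im_mul_ofReal, div_ofReal_im, sub_im, bergG_ofReal_im hx, sub_zero,
    bergStrip_add_pi_mul_I_im]
  field_simp

/-! ### Limits at the two ends of the strip -/

/-- Filter of points of the closed strip whose real part tends to the end `l`. -/
def stripEnd (l : Filter ℝ) : Filter ℂ := comap re l ⊓ 𝓟 closedStrip

lemma tendsto_re_stripEnd (l : Filter ℝ) : Tendsto re (stripEnd l) l :=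
  tendsto_comap.mono_left inf_le_left

lemma eventually_mem_closedStrip (l : Filter ℝ) : ∀ᶠ ζ in stripEnd l, ζ ∈ closedStrip :=
  mem_inf_of_right (mem_principal_self _)

lemma tendsto_integral_vertical {l : Filter ℝ} [l.IsCountablyGenerated] {g : ℂ → ℂ} {c : ℂ}
    (hg : ContinuousOn g closedStrip) (h : Tendsto g (stripEnd l) (𝓝 c)) :
    Tendsto (fun b : ℝ => ∫ y in (0 : ℝ)..Real.pi, g (b + y * I)) l (𝓝 (Real.pi * c)) := by
  have key : Tendsto (fun b : ℝ => ∫ y in (0 : ℝ)..Real.pi, g (b + y * I)) l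
      (𝓝 (∫ _ in (0 : ℝ)..Real.pi, c)) := by
    refine TendstoUniformlyOn.tendsto_intervalIntegral_of_continuousOn
      (Eventually.of_forall fun b => ?_) ?_
    · rw [uIcc_of_le Real.pi_pos.le]
      exact hg.comp (by fun_prop) fun y hy => add_mul_I_mem_closedStrip b hy.1 hy.2
    · rw [uIcc_of_le Real.pi_pos.le, Metric.tendstoUniformlyOn_iff]
      intro ε hε
      have h1 : ∀ᶠ ζ in comap re l, ζ ∈ closedStrip → dist (g ζ) c < ε :=
        eventually_inf_principal.1 (Metric.tendsto_nhds.1 h ε hε)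
      rw [eventually_comap] at h1
      filter_upwards [h1] with b hb y hy
      rw [dist_comm]
      exact hb _ (by simp) (add_mul_I_mem_closedStrip b hy.1 hy.2)
  simpa using key

lemma tendsto_log_one_add_div :
    Tendsto (fun u : ℂ => log (1 + u) / u) (𝓝[≠] 0) (𝓝 1) := by
  have h := (hasStrictDerivAt_log one_mem_slitPlane).hasDerivAt
  rw [hasDerivAt_iff_tendsto_slope_zero] at h
  simpa [div_eq_inv_mul] using h

lemma tendsto_exp_stripEnd_atBot : Tendsto exp (stripEnd atBot) (𝓝[≠] 0) := by
  refine tendsto_nhdsWithin_iff.2 ⟨?_, Eventually.of_forall exp_ne_zero⟩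
  rw [tendsto_zero_iff_norm_tendsto_zero]
  simp_rw [norm_exp]
  exact Real.tendsto_exp_atBot.comp (tendsto_re_stripEnd _)

lemma tendsto_exp_neg_stripEnd_atTop :
    Tendsto (fun ζ => exp (-ζ)) (stripEnd atTop) (𝓝[≠] 0) := by
  refine tendsto_nhdsWithin_iff.2 ⟨?_, Eventually.of_forall fun ζ => exp_ne_zero _⟩
  rw [tendsto_zero_iff_norm_tendsto_zero]
  simp_rw [norm_exp, neg_re]
  exact Real.tendsto_exp_neg_atTop_nhds_zero.comp (tendsto_re_stripEnd _)

lemma tendsto_inv_stripEnd {l : Filter ℝ} (h : Tendsto (fun x : ℝ => |x|) l atTop) :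
    Tendsto (fun ζ : ℂ => ζ⁻¹) (stripEnd l) (𝓝 0) := by
  refine tendsto_inv₀_cobounded.comp (tendsto_norm_atTop_iff_cobounded.1 ?_)
  exact tendsto_atTop_mono (fun ζ => abs_re_le_norm ζ) (h.comp (tendsto_re_stripEnd l))

/-- The argument of `1 + exp (-ζ)` lies in `(-π/2, 0]`, so adding `im ζ ∈ [0, π]` stays on the
principal branch. -/
lemma log_one_add_exp {ζ : ℂ} (hζ : ζ ∈ closedStrip) (h0 : 0 < ζ.re) :
    log (1 + exp ζ) = ζ + log (1 + exp (-ζ)) := by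
  have hre : 0 < (1 + exp (-ζ)).re := by
    have h1 : ‖exp (-ζ)‖ < 1 := by
      rw [norm_exp, neg_re, Real.exp_lt_one_iff]; linarith
    have h2 := abs_le.1 (abs_re_le_norm (exp (-ζ)))
    rw [add_re, one_re]; linarith [h2.1]
  have him : (1 + exp (-ζ)).im ≤ 0 := by
    rw [add_im, one_im, zero_add, exp_im, neg_im, Real.sin_neg, mul_neg, neg_nonpos]
    exact mul_nonneg (Real.exp_pos _).le (Real.sin_nonneg_of_nonneg_of_le_pi hζ.1 hζ.2)
  have hne : 1 + exp (-ζ) ≠ 0 := fun h => by rw [h] at hre; simp at hre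
  have harg : |arg (1 + exp (-ζ))| < Real.pi / 2 :=
    abs_arg_lt_pi_div_two_iff.2 (Or.inl hre)
  have harg' : arg (1 + exp (-ζ)) ≤ 0 := by
    rcases him.lt_or_eq with h | h
    · exact (arg_neg_iff.2 h).le
    · exact (arg_eq_zero_iff.2 ⟨hre.le, h⟩).le
  rw [← log_exp (x := ζ + log (1 + exp (-ζ)))]
  · rw [exp_add, exp_log hne, mul_add, ← exp_add, add_neg_cancel, exp_zero, mul_one, add_comm]
  · rw [add_im, log_im]
    linarith [(abs_lt.1 harg).1, hζ.1, Real.pi_pos]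
  · rw [add_im, log_im]
    linarith [hζ.2]

/-- With `m = log (1 + exp (-ζ))`, `log (1 + exp ζ) = ζ + m`, so `bergStrip ζ = (m / exp (-ζ)) * (1
+ m / ζ)⁻¹`, and both factors tend to `1`. -/
theorem tendsto_bergStrip_atTop : Tendsto bergStrip (stripEnd atTop) (𝓝 1) := by
  have hu := tendsto_exp_neg_stripEnd_atTop
  have h1 := tendsto_log_one_add_div.comp hu
  have h2 := tendsto_inv_stripEnd (l := atTop) tendsto_abs_atTop_atTop
  have h3 : Tendsto (fun ζ => log (1 + exp (-ζ))) (stripEnd atTop) (𝓝 0) := by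
    have h := h1.mul (tendsto_nhdsWithin_iff.1 hu).1
    rw [mul_zero] at h
    refine h.congr fun ζ => ?_
    exact div_mul_cancel₀ _ (exp_ne_zero _)
  have h4 := h1.mul (((tendsto_const_nhds (x := (1 : ℂ))).add (h3.mul h2)).inv₀ (by simp))
  simp only [mul_zero, add_zero, inv_one, mul_one] at h4
  have hpos : ∀ᶠ ζ in stripEnd atTop, 0 < ζ.re :=
    (tendsto_re_stripEnd atTop).eventually (eventually_gt_atTop 0)
  refine h4.congr' ?_
  filter_upwards [hpos, eventually_mem_closedStrip atTop] with ζ h0 hζ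
  have hζ0 : ζ ≠ 0 := fun h => by simp [h] at h0
  have hL : log (1 + exp ζ) ≠ 0 := by
    have him := exp_im_nonneg hζ
    intro h
    have hne : 1 + exp ζ ≠ 0 := by
      intro h'
      have h5 : ‖exp ζ‖ = 1 := by rw [show exp ζ = -1 by linear_combination h']; simp
      rw [norm_exp, Real.exp_eq_one_iff] at h5
      exact h0.ne' h5
    exact log_one_add_ne_zero (exp_ne_zero ζ) hne h
  have hlog := log_one_add_exp hζ h0
  simp only [bergStrip, Function.comp]
  rw [hlog] at hL ⊢
  have hd : 1 + log (1 + exp (-ζ)) * ζ⁻¹ = (ζ + log (1 + exp (-ζ))) / ζ := by field_simp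
  rw [hd]
  generalize log (1 + exp (-ζ)) = m at *
  rw [exp_neg]
  have := exp_ne_zero ζ
  field_simp
  ring

lemma tendsto_sq_mul_exp_stripEnd_atBot :
    Tendsto (fun ζ : ℂ => ζ ^ 2 * exp ζ) (stripEnd atBot) (𝓝 0) := by
  rw [tendsto_zero_iff_norm_tendsto_zero]
  have h1 : Tendsto (fun a : ℝ => a ^ 2 * Real.exp a + Real.pi ^ 2 * Real.exp a) atBot (𝓝 0) := by
    have h2 := (Real.tendsto_pow_mul_exp_neg_atTop_nhds_zero 2).comp tendsto_neg_atBot_atTop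
    have h3 := Real.tendsto_exp_atBot.const_mul (Real.pi ^ 2)
    simpa [Function.comp_def] using h2.add h3
  refine squeeze_zero' (Eventually.of_forall fun _ => norm_nonneg _) ?_
    (h1.comp (tendsto_re_stripEnd _))
  filter_upwards [eventually_mem_closedStrip atBot] with ζ hζ
  rw [norm_mul, norm_pow, norm_exp, Complex.sq_norm, normSq_apply, Function.comp, ← add_mul]
  refine mul_le_mul_of_nonneg_right ?_ (Real.exp_pos _).le
  nlinarith [hζ.1, hζ.2]

lemma tendsto_cauchyQuotient_atTop {x : ℝ} (hx : 0 < x) :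
    Tendsto (cauchyQuotient x) (stripEnd atTop) (𝓝 (1 - bergG x)) := by
  have hu := (tendsto_nhdsWithin_iff.1 tendsto_exp_neg_stripEnd_atTop).1
  have h := (tendsto_bergStrip_atTop.sub_const (bergG x)).div
    ((tendsto_const_nhds (x := (1 : ℂ))).sub (hu.const_mul (x : ℂ))) (by simp)
  simp only [mul_zero, sub_zero, div_one] at h
  refine h.congr' ?_
  filter_upwards [(tendsto_re_stripEnd atTop).eventually (eventually_gt_atTop (Real.log x))]
    with ζ hζ
  have hne : ζ ≠ Real.log x := by
    rintro rfl
    simp at hζ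
  rw [cauchyQuotient_eq hx hne, Pi.div_apply, exp_neg]
  have he := exp_ne_zero ζ
  rw [show (1 : ℂ) - x * (exp ζ)⁻¹ = (exp ζ - x) / exp ζ by field_simp]
  rw [div_div_eq_mul_div, div_mul_eq_mul_div]

lemma tendsto_cauchyQuotient_atBot {x : ℝ} (hx : 0 < x) :
    Tendsto (cauchyQuotient x) (stripEnd atBot) (𝓝 0) := by
  have hv := tendsto_exp_stripEnd_atBot
  have hv0 := (tendsto_nhdsWithin_iff.1 hv).1
  have h1 := (tendsto_log_one_add_div.comp hv).inv₀ one_ne_zero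
  have h2 := tendsto_inv_stripEnd (l := atBot) tendsto_abs_atBot_atTop
  have hx' : (0 : ℂ) - x ≠ 0 := by simp [hx.ne']
  -- With `L = log (1 + exp ζ)`, `bergStrip ζ * exp ζ = ζ² exp ζ * (exp ζ / ζ - exp ζ / L)`, where
  -- `exp ζ / L → 1`.
  have h := ((tendsto_sq_mul_exp_stripEnd_atBot.mul ((hv0.mul h2).sub h1)).sub
    (hv0.const_mul (bergG x))).div (hv0.sub_const (x : ℂ)) hx'
  simp only [mul_zero, zero_mul, sub_zero, zero_div] at h
  refine h.congr' ?_
  filter_upwards [(tendsto_re_stripEnd atBot).eventually (eventually_lt_atBot (Real.log x)),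
    (tendsto_re_stripEnd atBot).eventually (eventually_lt_atBot 0)] with ζ hζ h0
  have hne : ζ ≠ Real.log x := by
    rintro rfl
    simp at hζ
  have hζ0 : ζ ≠ 0 := fun h => by simp [h] at h0
  have hn : 1 + exp ζ ≠ 0 := by
    intro h'
    have h5 : ‖exp ζ‖ = 1 := by rw [show exp ζ = -1 by linear_combination h']; simp
    rw [norm_exp, Real.exp_eq_one_iff] at h5
    exact h0.ne h5
  have hL := log_one_add_ne_zero (exp_ne_zero ζ) hn
  rw [cauchyQuotient_eq hx hne, bergStrip, div_mul_eq_mul_div]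
  simp only [Function.comp, Pi.div_apply]
  congr 1
  field_simp

/-! ### Cauchy's theorem on rectangles and the representation -/

theorem tendsto_integral_bergRho {x : ℝ} (hx : 0 < x) :
    Tendsto (fun R : ℝ => ∫ t in (-R)..R,
      Real.pi * (Real.exp t * (bergRho (Real.exp t) / (x + Real.exp t)))) atTop
      (𝓝 (Real.pi * (1 - bergG x).re)) := by
  have hc := continuousOn_cauchyQuotient x
  have hR := tendsto_integral_vertical hc (tendsto_cauchyQuotient_atTop hx)
  have hL := (tendsto_integral_vertical hc (tendsto_cauchyQuotient_atBot hx)).comp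
    tendsto_neg_atTop_atBot
  have h := (continuous_re.tendsto _).comp (hR.sub hL)
  simp only [mul_zero, sub_zero, re_ofReal_mul] at h
  refine h.congr' ?_
  filter_upwards [eventually_gt_atTop 0] with R hRpos
  have hle : -R ≤ R := by linarith
  have rect := integral_boundary_rect_eq_zero_of_continuousOn_of_differentiableOn
    (cauchyQuotient x) ((-R : ℝ) : ℂ) (R + Real.pi * I) ?_ ?_
  · simp only [ofReal_re, ofReal_im, add_re, add_im, mul_re, mul_im, I_re, I_im, mul_zero,
      mul_one, sub_zero, add_zero, zero_add, ofReal_zero, zero_mul, smul_eq_mul] at rect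
    have him := congrArg im rect
    simp only [add_im, sub_im, I_mul_im, zero_im] at him
    have him_int : ∀ f : ℝ → ℂ, ContinuousOn f (uIcc (-R) R) →
        (∫ t in (-R)..R, f t).im = ∫ t in (-R)..R, (f t).im := fun f hf =>
      (imCLM.intervalIntegral_comp_comm hf.intervalIntegrable).symm
    rw [him_int (fun t => cauchyQuotient x t) (hc.comp (by fun_prop) fun t _ => ofReal_mem_closedStrip t),
      him_int (fun t => cauchyQuotient x (t + Real.pi * I)) (hc.comp (by fun_prop) fun t _ =>
        add_mul_I_mem_closedStrip t Real.pi_pos.le le_rfl)] at him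
    have hbot : ∫ t in (-R)..R, (cauchyQuotient x t).im = 0 := by
      refine intervalIntegral.integral_zero_ae ?_
      have : ∀ᵐ t : ℝ, t ≠ Real.log x := by
        simp [ae_iff]
      filter_upwards [this] with t ht _
      exact cauchyQuotient_ofReal_im hx ht
    rw [hbot] at him
    simp only [cauchyQuotient_add_pi_mul_I_im hx] at him
    simp only [Function.comp, sub_re]
    linarith
  · refine hc.mono fun ζ hζ => ?_
    have := hζ.2
    simp [uIcc_of_le Real.pi_pos.le] at this
    exact this
  · intro ζ hζ
    have := hζ.2
    simp [Real.pi_pos.le] at this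
    exact (differentiableAt_cauchyQuotient x this.1 this.2).differentiableWithinAt

theorem bergG_ofReal_representation {x : ℝ} (hx : 0 < x) :
    bergG x = 1 - ∫ t in Ioi (0 : ℝ), (bergRho t : ℂ) / ((x : ℂ) + (t : ℂ)) := by
  have hfun : (fun t : ℝ => (bergRho t : ℂ) / ((x : ℂ) + (t : ℂ))) =
      fun t : ℝ => ((bergRho t / (x + t) : ℝ) : ℂ) := by
    ext t; push_cast; rfl
  have hi : IntegrableOn (fun t : ℝ => bergRho t / (x + t)) (Ioi 0) := by
    have := integrableOn_bergRho_div (ofReal_mem_slitPlane.2 hx)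
    rw [hfun] at this
    simpa only [IntegrableOn, RCLike.re_eq_complex_re, ofReal_re] using Integrable.re this
  -- The substitution `s = exp t` turns the integral over the line into one over `(0, ∞)`;
  -- integrability, already known, identifies the symmetric limit with the full integral.
  have himg : Real.exp '' univ = Ioi 0 := by rw [image_univ, Real.range_exp]
  have hd : ∀ t ∈ (univ : Set ℝ), HasDerivWithinAt Real.exp (Real.exp t) univ t :=
    fun t _ => (Real.hasDerivAt_exp t).hasDerivWithinAt
  have hinj : InjOn Real.exp univ := Real.exp_injective.injOn
  have hi' := (integrableOn_image_iff_integrableOn_abs_deriv_smul MeasurableSet.univ hd hinj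
    (fun t : ℝ => bergRho t / (x + t))).1 (by rwa [himg])
  have he := integral_image_eq_integral_abs_deriv_smul MeasurableSet.univ hd hinj
    (fun t : ℝ => bergRho t / (x + t))
  simp only [himg, Real.abs_exp, smul_eq_mul, integrableOn_univ, Measure.restrict_univ] at hi' he
  have hlim := intervalIntegral_tendsto_integral (hi'.const_mul Real.pi)
    tendsto_neg_atTop_atBot tendsto_id
  have huniq := tendsto_nhds_unique hlim (tendsto_integral_bergRho hx)
  rw [integral_const_mul, ← he] at huniq
  have hre := mul_left_cancel₀ Real.pi_ne_zero huniq
  rw [hfun, integral_complex_ofReal, hre]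
  apply Complex.ext
  · simp
  · simp [bergG_ofReal_im hx]

theorem theorem1 :
    -- `G` is holomorphic in the cut plane
    DifferentiableOn ℂ bergG Complex.slitPlane ∧
    -- and extends the real function given by the same formula on the positive half-line;
    (∀ x : ℝ, 0 < x →
      bergG (x : ℂ) =
        (((1 - Real.log x / Real.log (1 + x)) * x * Real.log x : ℝ) : ℂ)) ∧
    -- the integral converges absolutely and represents `G` in the whole cut plane
    ∀ z ∈ Complex.slitPlane,
      MeasureTheory.IntegrableOn (fun t : ℝ => (bergRho t : ℂ) / (z + (t : ℂ)))
        (Set.Ioi (0 : ℝ)) MeasureTheory.volume ∧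
      bergG z = 1 - ∫ t in Set.Ioi (0 : ℝ), (bergRho t : ℂ) / (z + (t : ℂ)) :=
  ⟨differentiableOn_bergG, fun _ hx => bergG_ofReal hx, fun _ hz =>
    ⟨integrableOn_bergRho_div hz,
      bergG_representation_of_pos (fun _ hx => bergG_ofReal_representation hx) hz⟩⟩
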